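/- Let $K\ge 1$ be an integer, $r>0$, $T>0$, and let $M_0,\dots,M_K\ge 0$ with $\sum_{k=0}^K M_k=1$ be an initial inventory distribution. For vectors $V=(V_0,\dots,V_K)$ and $m=(m_0,\dots,m_K)$ put $\Delta V_k=V_k-V_{k-1}$ for $1\le k\le K$, $\eta(m)=\sum_{k=1}^K m_k$, and $$\phi_\epsilon(V,m)=\frac{1}{2+\epsilon\,\eta(m)}\Big(\sum_{k=1}^K m_k\,\Delta V_k-\eta(m)\Big),\qquad \lambda_k=\tfrac12\big(1-\Delta V_k+\epsilon\,\phi_\epsilon(V,m)\big),\qquad p_k=\tfrac12\big(1+\Delta V_k+\epsilon\,\phi_\epsilon(V,m)\big).$$ Suppose that $$0<\epsilon<C_1(K,T,r):=\frac{1}{K^2\,T\,2^{K+8}}\min\{1+KT,\sqrt r\}.$$ Then there exist differentiable functions $V_k,m_k:[0,T]\to\mathbb R$, $0\le k\le K$ (with one-sided derivatives at $0$ and $T$), that satisfy on $[0,T]$ the coupled HJB–Kolmogorov system of the mean field game with piecewise-linear intensity, $$\begin{aligned} &\frac{dV_k}{dt}-rV_k+\tfrac14\big(1-\Delta V_k+\epsilon\,\phi_\epsilon(V,m)\big)^2=0,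 && 1\le k\le K,\\ &\frac{dm_k}{dt}=\lambda_{k+1}m_{k+1}-\lambda_k m_k, && 1\le k\le K-1,\\ &\frac{dm_0}{dt}=\lambda_1 m_1,\qquad \frac{dm_K}{dt}=-\lambda_K m_K,\\ &V_0\equiv 0,\qquad V_k(T)=0\ \ (1\le k\le K),\qquad m_k(0)=M_k\ \ (0\le k\le K). \end{aligned}$$ Moreover, for every $t\in[0,T]$, $m(t)$ is a probability distribution on $\{0,\dots,K\}$, and the sales rates and prices satisfy $\lambda_k(t)\ge 0$ and $p_k(t)\ge 0$ for $1\le k\le K$. -/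

import Mathlib

namespace InventoryMFG

noncomputable section

/-- The backward difference `ΔV_k = V_k - V_{k-1}`, used only for `k ≥ 1`. -/
def bdiff (v : ℕ → ℝ) (k : ℕ) : ℝ := v k - v (k - 1)

/-- The proportion of active firms, `η(m) = ∑_{k=1}^K m_k`. -/
def activeMass (K : ℕ) (μ : ℕ → ℝ) : ℝ := ∑ k ∈ Finset.Icc 1 K, μ k

/-- `φ_ε(V, m) = (∑_{k=1}^K m_k ΔV_k - η(m)) / (2 + ε η(m))`. -/
def phi (K : ℕ) (ε : ℝ) (v μ : ℕ → ℝ) : ℝ :=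
  1 / (2 + ε * activeMass K μ) *
    ((∑ k ∈ Finset.Icc 1 K, μ k * bdiff v k) - activeMass K μ)

/-- The sales rate `λ_k = (1 - ΔV_k + ε φ_ε(V, m)) / 2` of a firm with `k ≥ 1` items. -/
def rate (K : ℕ) (ε : ℝ) (v μ : ℕ → ℝ) (k : ℕ) : ℝ :=
  1 / 2 * (1 - bdiff v k + ε * phi K ε v μ)

/-- The price `p_k = (1 + ΔV_k + ε φ_ε(V, m)) / 2` quoted by a firm with `k ≥ 1` items;
it is `(a + c p̄ + ΔV_k) / 2` with `a = 1 / (1 + ε η)`, `c = ε η / (1 + ε η)` and the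
average price `p̄` eliminated. -/
def price (K : ℕ) (ε : ℝ) (v μ : ℕ → ℝ) (k : ℕ) : ℝ :=
  1 / 2 * (1 + bdiff v k + ε * phi K ε v μ)

/-- `(V_k, m_k)`, `0 ≤ k ≤ K`, solves the coupled HJB-Kolmogorov system on `[0, T]`, with
one-sided derivatives at the two end points. Only indices `k ≤ K` and times in `[0, T]` matter. -/
structure IsSolution (K : ℕ) (r T ε : ℝ) (M : ℕ → ℝ) (V m : ℕ → ℝ → ℝ) : Prop where
  hjb : ∀ k, 1 ≤ k → k ≤ K → ∀ t ∈ Set.Icc 0 T,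
    HasDerivWithinAt (V k)
      (r * V k t - 1 / 4 *
        (1 - bdiff (fun j => V j t) k
          + ε * phi K ε (fun j => V j t) (fun j => m j t)) ^ 2)
      (Set.Icc 0 T) t
  kolmogorov : ∀ k, 1 ≤ k → k < K → ∀ t ∈ Set.Icc 0 T,
    HasDerivWithinAt (m k)
      (rate K ε (fun j => V j t) (fun j => m j t) (k + 1) * m (k + 1) t
        - rate K ε (fun j => V j t) (fun j => m j t) k * m k t)
      (Set.Icc 0 T) t
  kolmogorov_zero : ∀ t ∈ Set.Icc 0 T,
    HasDerivWithinAt (m 0)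
      (rate K ε (fun j => V j t) (fun j => m j t) 1 * m 1 t)
      (Set.Icc 0 T) t
  kolmogorov_top : ∀ t ∈ Set.Icc 0 T,
    HasDerivWithinAt (m K)
      (-(rate K ε (fun j => V j t) (fun j => m j t) K * m K t))
      (Set.Icc 0 T) t
  boundary : ∀ t ∈ Set.Icc 0 T, V 0 t = 0
  terminal : ∀ k, 1 ≤ k → k ≤ K → V k T = 0
  initial : ∀ k, k ≤ K → m k 0 = M k

/-- The bound `C₁(K, T, r) = min {1 + K T, √r} / (K² T 2^{K+8})` on the interaction parameter. -/
def C₁ (K : ℕ) (T r : ℝ) : ℝ :=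
  1 / ((K : ℝ) ^ 2 * T * 2 ^ (K + 8)) * min (1 + (K : ℝ) * T) (Real.sqrt r)

end

end InventoryMFG

/-! The two halves of the system interact only through the scalar path `b = 1 + ε φ`. With `b`
frozen, the HJB equations are triangular upwards in `k`, starting from `V_0 = 0`. The Kolmogorov
equations, written for the tails `P k = ∑_{j ≥ k} m_j`, are triangular downwards from `P (K + 1) =
0`. Each is a chain of scalar equations with an invariant interval (`exists_chain`). The response to
`b` yields a new path `aggregate`, again between `2 / (2 + ε)` and `1`, and an equilibrium is a
fixed point of this map on `C([0, T])`.

The map contracts by the factor `1 / 2`. Comparison arguments bound the change of values, then of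
rates, then of tails, and `abs_aggregate_sub_le` contributes a factor `ε`. The condition on `ε`
leaves two regimes (`horizon_small_or_discount_large`). If `ε T K ^ 3` is small, estimates growing
linearly in `T` suffice. Otherwise `r ≥ 1` and `ε K ^ 3` is small. Discounting then keeps marginal
values at most `1 / 4` and sales rates at least `1 / 4`, which damps perturbations uniformly in `T`.

Rates are truncated at `0` in the frozen problem. In both regimes the barriers `diff_le_div` and
`diff_le_inv` give `ΔV_k ≤ b`, so the truncation is inactive. Since `λ_k = (b - ΔV_k) / 2` and `p_k
= (b + ΔV_k) / 2`, this bound and `ΔV_k ≥ 0` give the signs. -/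

namespace InventoryMFG

open Set

/-! ### Scalar differential inequalities and differential equations -/

/-- A function that is nonpositive at `0` and whose derivative is nonpositive wherever the function
is positive stays nonpositive. -/
theorem nonpos_of_deriv_nonpos_of_pos {T : ℝ} {z z' : ℝ → ℝ}
    (hz : ∀ t ∈ Icc 0 T, HasDerivWithinAt z (z' t) (Icc 0 T) t) (h0 : z 0 ≤ 0)
    (hpos : ∀ t ∈ Icc 0 T, 0 < z t → z' t ≤ 0) : ∀ t ∈ Icc 0 T, z t ≤ 0 := by
  intro t ht
  by_contra! hzt
  have hcont : ContinuousOn z (Icc 0 T) := fun s hs => (hz s hs).continuousWithinAt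
  have hsub : Icc 0 t ⊆ Icc 0 T := Icc_subset_Icc_right ht.2
  -- Take the last time `s ≤ t` with `z s ≤ 0`; after it `z` is positive, hence nonincreasing, and
  -- cannot reach a positive value.
  have hcomp : IsCompact (Icc 0 t ∩ z ⁻¹' Iic 0) :=
    isCompact_Icc.of_isClosed_subset
      ((hcont.mono hsub).preimage_isClosed_of_isClosed isClosed_Icc isClosed_Iic) inter_subset_left
  obtain ⟨s, ⟨hs, hzs⟩, hmax⟩ := hcomp.exists_isGreatest ⟨0, ⟨le_rfl, ht.1⟩, h0⟩
  have hst : s ≤ t := hs.2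
  have hsub' : Icc s t ⊆ Icc 0 T := Icc_subset_Icc hs.1 ht.2
  have hderiv : ∀ u ∈ Ioo s t, HasDerivAt z (z' u) u := fun u hu =>
    (hz u (hsub' ⟨hu.1.le, hu.2.le⟩)).hasDerivAt
      (Icc_mem_nhds (hs.1.trans_lt hu.1) (hu.2.trans_le ht.2))
  have hanti : AntitoneOn z (Icc s t) := by
    refine antitoneOn_of_deriv_nonpos (convex_Icc s t) (hcont.mono hsub') ?_ ?_
    · rw [interior_Icc]
      exact fun u hu => (hderiv u hu).differentiableAt.differentiableWithinAt
    · rw [interior_Icc]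
      intro u hu
      rw [(hderiv u hu).deriv]
      refine hpos u (hsub' ⟨hu.1.le, hu.2.le⟩) ?_
      by_contra! hzu
      exact absurd (hmax ⟨⟨hs.1.trans hu.1.le, hu.2.le⟩, hzu⟩) (not_le.2 hu.1)
  have := hanti (left_mem_Icc.2 hst) (right_mem_Icc.2 hst) hst
  exact absurd (this.trans hzs) (not_le.2 hzt)

/-- A scalar equation whose field points into `[α, β]` at both end points has a solution
with values in `[α, β]` on all of `[0, T]`. -/
theorem exists_solution_mem_Icc {T α β L : ℝ} (hT : 0 ≤ T) (hαβ : α ≤ β) {F : ℝ → ℝ → ℝ}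
    (hF : Continuous fun p : ℝ × ℝ => F p.1 p.2)
    (hL : ∀ t ∈ Icc 0 T, ∀ x ∈ Icc α β, ∀ y ∈ Icc α β, |F t x - F t y| ≤ L * |x - y|)
    (hα : ∀ t ∈ Icc 0 T, 0 ≤ F t α) (hβ : ∀ t ∈ Icc 0 T, F t β ≤ 0)
    {x₀ : ℝ} (hx₀ : x₀ ∈ Icc α β) :
    ∃ x : ℝ → ℝ, Continuous x ∧ x 0 = x₀ ∧ (∀ t, x t ∈ Icc α β) ∧
      ∀ t ∈ Icc 0 T, HasDerivWithinAt x (F t (x t)) (Icc 0 T) t := by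
  -- Clamping the state makes the field bounded and globally Lipschitz, so Picard–Lindelöf on a ball
  -- of radius `C * T` covers all of `[0, T]` at once. The signs at `α` and `β` then show that the
  -- clamp never acts.
  set cl : ℝ → ℝ := fun x => projIcc α β hαβ x with hcl
  have hcl_mem : ∀ x, cl x ∈ Icc α β := fun x => (projIcc α β hαβ x).2
  have hcl_lip : ∀ x y, |cl x - cl y| ≤ |x - y| := fun x y => abs_projIcc_sub_projIcc hαβ
  have hcl_self : ∀ x ∈ Icc α β, cl x = x := fun x hx => by simp [hcl, projIcc_of_mem hαβ hx]
  obtain ⟨C, hC⟩ := ((isCompact_Icc (a := (0 : ℝ)) (b := T)).prod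
    (isCompact_Icc (a := α) (b := β))).exists_bound_of_continuousOn hF.continuousOn
  have hpic : IsPicardLindelof (fun t x => F t (cl x)) (⟨0, le_rfl, hT⟩ : Icc (0 : ℝ) T) x₀
      (C.toNNReal * T.toNNReal) 0 C.toNNReal L.toNNReal :=
    { lipschitzOnWith := fun t ht => by
        refine LipschitzOnWith.of_dist_le_mul fun x _ y _ => ?_
        rw [Real.dist_eq, Real.dist_eq]
        exact (hL t ht _ (hcl_mem x) _ (hcl_mem y)).trans
          (mul_le_mul (Real.le_coe_toNNReal L) (hcl_lip x y) (abs_nonneg _) (NNReal.coe_nonneg _))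
      continuousOn := fun x _ => by
        have : Continuous fun t => F t (cl x) := hF.comp (continuous_id.prodMk continuous_const)
        exact this.continuousOn
      norm_le := fun t ht x _ => (hC (t, cl x) ⟨ht, hcl_mem x⟩).trans (Real.le_coe_toNNReal C)
      mul_max_le := by simp [Real.coe_toNNReal T hT, hT] }
  obtain ⟨y, hy0, hy⟩ := hpic.exists_eq_forall_mem_Icc_hasDerivWithinAt₀
  simp only at hy0
  have hlow : ∀ t ∈ Icc 0 T, α - y t ≤ 0 := by
    refine nonpos_of_deriv_nonpos_of_pos (z' := fun t => 0 - F t (cl (y t)))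
      (fun t ht => (hasDerivWithinAt_const t _ α).sub (hy t ht)) (by rw [hy0]; linarith [hx₀.1]) ?_
    intro t ht hpos
    have : cl (y t) = α := by simp [hcl, projIcc_of_le_left hαβ (by linarith : y t ≤ α)]
    simpa [this] using hα t ht
  have hup : ∀ t ∈ Icc 0 T, y t - β ≤ 0 := by
    refine nonpos_of_deriv_nonpos_of_pos (z' := fun t => F t (cl (y t)))
      (fun t ht => (hy t ht).sub_const β) (by rw [hy0]; linarith [hx₀.2]) ?_
    intro t ht hpos
    have : cl (y t) = β := by simp [hcl, projIcc_of_right_le hαβ (by linarith : β ≤ y t)]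
    simpa [this] using hβ t ht
  have hmem : ∀ t ∈ Icc 0 T, y t ∈ Icc α β := fun t ht =>
    ⟨by linarith [hlow t ht], by linarith [hup t ht]⟩
  have hycont : ContinuousOn y (Icc 0 T) := fun t ht => (hy t ht).continuousWithinAt
  have hself : ∀ t ∈ Icc 0 T, y (projIcc 0 T hT t) = y t := fun t ht => by
    rw [projIcc_of_mem hT ht]
  refine ⟨fun t => y (projIcc 0 T hT t), ?_, ?_, fun t => hmem _ (projIcc 0 T hT t).2, ?_⟩
  · exact hycont.comp_continuous (continuous_subtype_val.comp continuous_projIcc)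
      fun t => (projIcc 0 T hT t).2
  · exact (hself 0 ⟨le_rfl, hT⟩).trans hy0
  · intro t ht
    have := hy t ht
    rw [hcl_self _ (hmem t ht)] at this
    simpa only [hself t ht] using this.congr hself (hself t ht)

/-- Solutions of a triangular system `X_{k+1}' = F_k(t, X_k, X_{k+1})` with `X_0 = 0`, where
`[0, B (k + 1)]` is invariant for the `k`-th equation. -/
theorem exists_chain {T : ℝ} (hT : 0 ≤ T) {B L : ℕ → ℝ} (hB : ∀ k, 0 ≤ B k)
    {F : ℕ → ℝ → ℝ → ℝ → ℝ} (hF : ∀ k, Continuous fun p : ℝ × ℝ × ℝ => F k p.1 p.2.1 p.2.2)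
    (hL : ∀ k, ∀ t ∈ Icc 0 T, ∀ y ∈ Icc 0 (B k), ∀ x ∈ Icc 0 (B (k + 1)), ∀ x' ∈ Icc 0 (B (k + 1)),
      |F k t y x - F k t y x'| ≤ L k * |x - x'|)
    (h0 : ∀ k, ∀ t ∈ Icc 0 T, ∀ y ∈ Icc 0 (B k), 0 ≤ F k t y 0)
    (hB' : ∀ k, ∀ t ∈ Icc 0 T, ∀ y ∈ Icc 0 (B k), F k t y (B (k + 1)) ≤ 0)
    {a : ℕ → ℝ} (ha : ∀ k, a k ∈ Icc 0 (B (k + 1))) :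
    ∃ X : ℕ → ℝ → ℝ, (∀ t, X 0 t = 0) ∧ (∀ k, Continuous (X k)) ∧
      (∀ k t, X k t ∈ Icc 0 (B k)) ∧ (∀ k, X (k + 1) 0 = a k) ∧
      ∀ k, ∀ t ∈ Icc 0 T, HasDerivWithinAt (X (k + 1)) (F k t (X k t) (X (k + 1) t)) (Icc 0 T) t := by
  have step : ∀ (k : ℕ) (y : {y : ℝ → ℝ // Continuous y ∧ ∀ t, y t ∈ Icc 0 (B k)}),
      ∃ x : {x : ℝ → ℝ // Continuous x ∧ ∀ t, x t ∈ Icc 0 (B (k + 1))}, x.1 0 = a k ∧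
        ∀ t ∈ Icc 0 T, HasDerivWithinAt x.1 (F k t (y.1 t) (x.1 t)) (Icc 0 T) t := by
    rintro k ⟨y, hyc, hy⟩
    obtain ⟨x, hxc, hx0, hx, hd⟩ := exists_solution_mem_Icc hT (hB (k + 1))
      (F := fun t x => F k t (y t) x)
      ((hF k).comp (continuous_fst.prodMk ((hyc.comp continuous_fst).prodMk continuous_snd)))
      (fun t ht x hx x' hx' => hL k t ht _ (hy t) x hx x' hx')
      (fun t ht => h0 k t ht _ (hy t)) (fun t ht => hB' k t ht _ (hy t)) (ha k)
    exact ⟨⟨x, hxc, hx⟩, hx0, hd⟩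
  choose next hnext0 hnext using step
  let X : ∀ k, {y : ℝ → ℝ // Continuous y ∧ ∀ t, y t ∈ Icc 0 (B k)} := fun k =>
    Nat.rec ⟨fun _ => 0, continuous_const, fun _ => ⟨le_rfl, hB 0⟩⟩ (fun k y => next k y) k
  exact ⟨fun k => (X k).1, fun _ => rfl, fun k => (X k).2.1, fun k => (X k).2.2,
    fun k => hnext0 k (X k), fun k => hnext k (X k)⟩

/-! ### The truncated Hamiltonian -/

/-- `max_{λ ≥ 0} λ (x - λ) = (x⁺)² / 4`. -/
noncomputable def hamiltonian (x : ℝ) : ℝ := (max x 0) ^ 2 / 4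

theorem hamiltonian_nonneg (x : ℝ) : 0 ≤ hamiltonian x := by unfold hamiltonian; positivity

theorem hamiltonian_of_nonneg {x : ℝ} (hx : 0 ≤ x) : hamiltonian x = x ^ 2 / 4 := by
  rw [hamiltonian, max_eq_left hx]

theorem hamiltonian_of_nonpos {x : ℝ} (hx : x ≤ 0) : hamiltonian x = 0 := by
  rw [hamiltonian, max_eq_right hx]; norm_num

theorem continuous_hamiltonian : Continuous hamiltonian := by unfold hamiltonian; fun_prop

theorem hamiltonian_mono : Monotone hamiltonian := by
  intro x y hxy
  have h := max_le_max_right 0 hxy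
  have h0 : 0 ≤ max x 0 := le_max_right _ _
  unfold hamiltonian
  nlinarith

theorem abs_hamiltonian_sub_le {A x y : ℝ} (hA : 0 ≤ A) (hx : x ≤ A) (hy : y ≤ A) :
    |hamiltonian x - hamiltonian y| ≤ A / 2 * |x - y| := by
  have hx0 : 0 ≤ max x 0 := le_max_right _ _
  have hy0 : 0 ≤ max y 0 := le_max_right _ _
  have hxA : max x 0 ≤ A := max_le hx hA
  have hyA : max y 0 ≤ A := max_le hy hA
  have h : |max x 0 - max y 0| ≤ |x - y| := abs_max_sub_max_le_abs x y 0
  have : hamiltonian x - hamiltonian y = (max x 0 + max y 0) / 4 * (max x 0 - max y 0) := by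
    unfold hamiltonian; ring
  rw [this, abs_mul, abs_of_nonneg (by positivity)]
  exact mul_le_mul (by linarith) h (abs_nonneg _) (by linarith)

theorem hamiltonian_sub_le {x y c : ℝ} (hx : x ≤ 1) (hc : 0 ≤ c) (hxy : x - y ≤ c) :
    hamiltonian x - hamiltonian y ≤ c / 2 := by
  rcases le_total x y with h | h
  · linarith [hamiltonian_mono h]
  · have := abs_hamiltonian_sub_le zero_le_one hx (h.trans hx)
    rw [abs_of_nonneg (sub_nonneg.2 h)] at this
    linarith [le_abs_self (hamiltonian x - hamiltonian y)]

/-! ### The value functions for a given price path -/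

/-- The value functions `U k`, in the time to go, against the path `b` of `1 + ε φ`. -/
structure IsValueChain (r T : ℝ) (b : ℝ → ℝ) (U : ℕ → ℝ → ℝ) : Prop where
  zero : ∀ t, U 0 t = 0
  continuous : ∀ k, Continuous (U k)
  initial : ∀ k, U k 0 = 0
  deriv : ∀ k, ∀ t ∈ Icc 0 T, HasDerivWithinAt (U (k + 1))
    (-r * U (k + 1) t + hamiltonian (b t - (U (k + 1) t - U k t))) (Icc 0 T) t

theorem exists_isValueChain {r T : ℝ} (hr : 0 < r) (hT : 0 ≤ T) {b : ℝ → ℝ} (hb : Continuous b)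
    (hb1 : ∀ t, b t ≤ 1) : ∃ U, IsValueChain r T b U := by
  -- `[0, k]` is invariant: at `x = k + 1` with `y ≤ k`, the argument `b - (x - y)` is nonpositive
  -- and the Hamiltonian vanishes.
  obtain ⟨U, hU0, hUc, -, hUi, hUd⟩ := exists_chain hT (B := fun k => (k : ℝ))
    (L := fun k => r + (1 + k) / 2) (F := fun _ t y x => -r * x + hamiltonian (b t - (x - y)))
    (a := fun _ => 0) (fun k => k.cast_nonneg)
    (fun k => by
      have := continuous_hamiltonian
      fun_prop)
    (fun k t ht y hy x hx x' hx' => by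
      have h := abs_hamiltonian_sub_le (A := 1 + k) (x := b t - (x - y)) (y := b t - (x' - y))
        (by positivity) (by linarith [hb1 t, hy.2, hx.1]) (by linarith [hb1 t, hy.2, hx'.1])
      have e : b t - (x - y) - (b t - (x' - y)) = -(x - x') := by ring
      rw [e, abs_neg] at h
      calc |-r * x + hamiltonian (b t - (x - y)) - (-r * x' + hamiltonian (b t - (x' - y)))|
          = |-r * (x - x') + (hamiltonian (b t - (x - y)) - hamiltonian (b t - (x' - y)))| := by
            congr 1; ring
        _ ≤ |-r * (x - x')| + _ := abs_add_le _ _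
        _ ≤ r * |x - x'| + (1 + k) / 2 * |x - x'| := by
            rw [abs_mul, abs_neg, abs_of_pos hr]; gcongr
        _ = _ := by ring)
    (fun k t ht y hy => by simpa using hamiltonian_nonneg _)
    (fun k t ht y hy => by
      push_cast
      rw [hamiltonian_of_nonpos (by linarith [hb1 t, hy.2])]
      have : (0 : ℝ) ≤ r * (k + 1) := by positivity
      linarith)
    (fun k => ⟨le_rfl, by positivity⟩)
  exact ⟨U, hU0, hUc, fun k => by cases k with
    | zero => exact hU0 0
    | succ k => exact hUi k, hUd⟩

namespace IsValueChain

variable {r T : ℝ} {b b' : ℝ → ℝ} {U U' : ℕ → ℝ → ℝ}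

theorem hasDerivWithinAt_diff (hU : IsValueChain r T b U) (k : ℕ) {t : ℝ} (ht : t ∈ Icc 0 T) :
    HasDerivWithinAt (fun s => U (k + 2) s - U (k + 1) s)
      (-r * (U (k + 2) t - U (k + 1) t) + hamiltonian (b t - (U (k + 2) t - U (k + 1) t))
        - hamiltonian (b t - (U (k + 1) t - U k t))) (Icc 0 T) t :=
  ((hU.deriv (k + 1) t ht).sub (hU.deriv k t ht)).congr_deriv (by ring)

/-- If a marginal value is negative while the one below it is not, monotonicity of the Hamiltonian
makes its derivative nonnegative, so it cannot cross zero downwards. -/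
theorem diff_nonneg (hU : IsValueChain r T b U) (hr : 0 < r) (k : ℕ) :
    ∀ t ∈ Icc 0 T, 0 ≤ U (k + 1) t - U k t := by
  induction k with
  | zero =>
    suffices ∀ t ∈ Icc 0 T, -U 1 t ≤ 0 from fun t ht => by
      have := this t ht
      rw [zero_add, hU.zero]; linarith
    refine nonpos_of_deriv_nonpos_of_pos (fun t ht => (hU.deriv 0 t ht).neg)
      (by simp [hU.initial]) fun t ht hpos => ?_
    rw [zero_add]
    have := hamiltonian_nonneg (b t - (U 1 t - U 0 t))
    nlinarith
  | succ k ih =>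
    suffices ∀ t ∈ Icc 0 T, -(U (k + 2) t - U (k + 1) t) ≤ 0 from fun t ht => by
      linarith [this t ht]
    refine nonpos_of_deriv_nonpos_of_pos (fun t ht => (hU.hasDerivWithinAt_diff k ht).neg)
      (by simp [hU.initial]) fun t ht hpos => ?_
    have := hamiltonian_mono (show b t - (U (k + 1) t - U k t) ≤
      b t - (U (k + 2) t - U (k + 1) t) by linarith [ih t ht])
    nlinarith

/-- Barrier for the marginal values: any supersolution of `x' = -r x + H(1 - x)`. -/
theorem diff_le_of_supersolution (hU : IsValueChain r T b U) (hr : 0 < r) (hb1 : ∀ t, b t ≤ 1)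
    {S S' : ℝ → ℝ} (hS : ∀ t ∈ Icc 0 T, HasDerivWithinAt S (S' t) (Icc 0 T) t) (hS0 : 0 ≤ S 0)
    (hS' : ∀ t ∈ Icc 0 T, -r * S t + hamiltonian (1 - S t) ≤ S' t) (k : ℕ) :
    ∀ t ∈ Icc 0 T, U (k + 1) t - U k t ≤ S t := by
  suffices ∀ t ∈ Icc 0 T, U (k + 1) t - U k t - S t ≤ 0 from fun t ht => by
    linarith [this t ht]
  have key : ∀ t ∈ Icc 0 T, 0 < U (k + 1) t - U k t - S t →
      -r * (U (k + 1) t - U k t) + hamiltonian (b t - (U (k + 1) t - U k t)) - S' t ≤ 0 := by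
    intro t ht hpos
    have := hamiltonian_mono (show b t - (U (k + 1) t - U k t) ≤ 1 - S t by linarith [hb1 t])
    have := hS' t ht
    nlinarith
  cases k with
  | zero =>
    refine nonpos_of_deriv_nonpos_of_pos
      (fun t ht => ((hU.deriv 0 t ht).sub (hasDerivWithinAt_const t _ (0 : ℝ))).congr_of_mem
        (fun s _ => ?_) ht |>.sub (hS t ht)) (by simpa [hU.initial] using hS0) fun t ht hpos => ?_
    · simp [hU.zero]
    · have := key t ht hpos
      simp only [hU.zero, sub_zero, zero_add] at this ⊢
      exact this
  | succ k =>
    refine nonpos_of_deriv_nonpos_of_pos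
      (fun t ht => (hU.hasDerivWithinAt_diff k ht).sub (hS t ht))
      (by simpa [hU.initial] using hS0) fun t ht hpos => ?_
    have := key t ht hpos
    -- The term inherited from the level below enters with a minus sign and can be dropped.
    have := hamiltonian_nonneg (b t - (U (k + 1) t - U k t))
    linarith

/-- The barrier is the exact solution of `x' = (1 - x) ^ 2 / 4`, `x 0 = 0`, the undiscounted
equation with `b = 1`. -/
theorem diff_le_div (hU : IsValueChain r T b U) (hr : 0 < r) (hb1 : ∀ t, b t ≤ 1) (k : ℕ) :
    ∀ t ∈ Icc 0 T, U (k + 1) t - U k t ≤ t / (4 + t) := by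
  refine hU.diff_le_of_supersolution hr hb1 (S' := fun t => 4 / (4 + t) ^ 2) (fun t ht => ?_)
    (by simp) (fun t ht => ?_) k
  · have h4 : 4 + t ≠ 0 := by linarith [ht.1]
    refine (((hasDerivAt_id t).div ((hasDerivAt_id t).const_add 4) h4).congr_deriv ?_).hasDerivWithinAt
    simp only [id]
    ring
  · have h4 : 0 < 4 + t := by linarith [ht.1]
    have e : 1 - t / (4 + t) = 4 / (4 + t) := by field_simp; ring
    rw [e, hamiltonian_of_nonneg (by positivity)]
    have : 0 ≤ r * (t / (4 + t)) := mul_nonneg hr.le (div_nonneg ht.1 h4.le)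
    have : (4 / (4 + t)) ^ 2 / 4 = 4 / (4 + t) ^ 2 := by field_simp
    linarith

theorem diff_le_one (hU : IsValueChain r T b U) (hr : 0 < r) (hb1 : ∀ t, b t ≤ 1) (k : ℕ) :
    ∀ t ∈ Icc 0 T, U (k + 1) t - U k t ≤ 1 := fun t ht =>
  (hU.diff_le_div hr hb1 k t ht).trans
    (div_le_one_of_le₀ (by linarith) (by linarith [ht.1]))

/-- A constant barrier: discounting at level `1 / (4 * r)` removes `1 / 4`, the largest possible
gain `hamiltonian 1`. -/
theorem diff_le_inv (hU : IsValueChain r T b U) (hr : 0 < r) (hb1 : ∀ t, b t ≤ 1) (k : ℕ) :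
    ∀ t ∈ Icc 0 T, U (k + 1) t - U k t ≤ 1 / (4 * r) := by
  refine hU.diff_le_of_supersolution hr hb1 (S := fun _ => 1 / (4 * r)) (S' := fun _ => 0)
    (fun t _ => hasDerivWithinAt_const _ _ _) (by positivity) (fun t ht => ?_) k
  have h1 : hamiltonian (1 - 1 / (4 * r)) ≤ hamiltonian 1 :=
    hamiltonian_mono (by linarith [show 0 ≤ 1 / (4 * r) by positivity])
  rw [hamiltonian_of_nonneg zero_le_one] at h1
  have : r * (1 / (4 * r)) = 1 / 4 := by field_simp
  linarith

/-- Uniform in time: once the gap exceeds `(k + 1) * β`, the induction hypothesis makes the marginal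
values differ by more than `β`, which outweighs `b - b'`, so the gap stops growing. -/
theorem sub_le_nat_mul (hU : IsValueChain r T b U) (hU' : IsValueChain r T b' U') (hr : 0 < r)
    {β : ℝ} (hβ : ∀ t ∈ Icc 0 T, b t - b' t ≤ β) (hβ0 : 0 ≤ β) (k : ℕ) :
    ∀ t ∈ Icc 0 T, U k t - U' k t ≤ k * β := by
  induction k with
  | zero => intro t _; simp [hU.zero, hU'.zero]
  | succ k ih =>
    have hkβ : 0 ≤ k * β := by positivity
    suffices ∀ t ∈ Icc 0 T, U (k + 1) t - U' (k + 1) t - (k + 1) * β ≤ 0 from fun t ht => by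
      push_cast; linarith [this t ht]
    refine nonpos_of_deriv_nonpos_of_pos
      (fun t ht => ((hU.deriv k t ht).sub (hU'.deriv k t ht)).sub_const _)
      (by simp only [hU.initial, hU'.initial]; nlinarith) fun t ht hpos => ?_
    have := hamiltonian_mono (show b t - (U (k + 1) t - U k t) ≤
      b' t - (U' (k + 1) t - U' k t) by linarith [ih t ht, hβ t ht])
    nlinarith

/-- Better for short horizons: the Hamiltonian is `1 / 2`-Lipschitz on arguments at most `1`, so
above the barrier the gap grows at rate at most `β / 2`. -/
theorem sub_le_nat_mul_time (hU : IsValueChain r T b U) (hU' : IsValueChain r T b' U')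
    (hr : 0 < r) (hb1 : ∀ t, b t ≤ 1) {β : ℝ} (hβ : ∀ t ∈ Icc 0 T, b t - b' t ≤ β) (hβ0 : 0 ≤ β)
    (k : ℕ) : ∀ t ∈ Icc 0 T, U k t - U' k t ≤ k * (t / 2 * β) := by
  induction k with
  | zero => intro t _; simp [hU.zero, hU'.zero]
  | succ k ih =>
    suffices ∀ t ∈ Icc 0 T, U (k + 1) t - U' (k + 1) t - t * ((k + 1) / 2 * β) ≤ 0 from
      fun t ht => by push_cast; linarith [this t ht]
    refine nonpos_of_deriv_nonpos_of_pos
      (fun t ht => ((hU.deriv k t ht).sub (hU'.deriv k t ht)).sub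
        ((hasDerivWithinAt_id t _).mul_const _))
      (by simp [hU.initial, hU'.initial]) fun t ht hpos => ?_
    have hkβ : 0 ≤ k * β := by positivity
    have htβ : 0 ≤ t * β := mul_nonneg ht.1 hβ0
    have htkβ : 0 ≤ t * (k * β) := mul_nonneg ht.1 hkβ
    have := hamiltonian_sub_le (x := b t - (U (k + 1) t - U k t))
      (y := b' t - (U' (k + 1) t - U' k t)) (by linarith [hb1 t, hU.diff_nonneg hr k t ht])
      hβ0 (by linarith [ih t ht, hβ t ht])
    have : 0 ≤ r * (U (k + 1) t - U' (k + 1) t) := mul_nonneg hr.le (by linarith)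
    linarith

end IsValueChain

/-! ### The tails of the inventory distribution for given sales rates -/

/-- `P k = ∑_{j ≥ k} m_j`, transported with the rates `lam k` from the initial tails `p k`. -/
structure IsTailChain (K : ℕ) (T : ℝ) (lam : ℕ → ℝ → ℝ) (p : ℕ → ℝ) (P : ℕ → ℝ → ℝ) : Prop where
  top : ∀ t, P (K + 1) t = 0
  continuous : ∀ k, Continuous (P k)
  mem : ∀ k t, P k t ∈ Icc (0 : ℝ) 1
  initial : ∀ k, k ≤ K → P k 0 = p k
  deriv : ∀ k, k ≤ K → ∀ t ∈ Icc 0 T,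
    HasDerivWithinAt (P k) (-(lam k t * (P k t - P (k + 1) t))) (Icc 0 T) t

theorem exists_isTailChain {K : ℕ} {T : ℝ} (hT : 0 ≤ T) {lam : ℕ → ℝ → ℝ}
    (hc : ∀ k, Continuous (lam k)) (h0 : ∀ k t, 0 ≤ lam k t) (h1 : ∀ k, ∀ t ∈ Icc 0 T, lam k t ≤ 1)
    {p : ℕ → ℝ} (hp : ∀ k, p k ∈ Icc (0 : ℝ) 1) : ∃ P, IsTailChain K T lam p P := by
  -- The chain is built from the top: `X j` is the tail of index `K + 1 - j`.
  obtain ⟨X, hX0, hXc, hXm, hXi, hXd⟩ := exists_chain hT (B := fun _ => 1) (L := fun _ => 1)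
    (F := fun k t y x => -(lam (K - k) t * (x - y))) (a := fun k => p (K - k))
    (fun _ => zero_le_one)
    (fun k => by
      have := hc (K - k)
      fun_prop)
    (fun k t ht y hy x hx x' hx' => by
      have e : -(lam (K - k) t * (x - y)) - -(lam (K - k) t * (x' - y))
        = -(lam (K - k) t * (x - x')) := by ring
      rw [e, abs_neg, abs_mul, abs_of_nonneg (h0 _ _)]
      exact mul_le_mul_of_nonneg_right (h1 _ t ht) (abs_nonneg _))
    (fun k t ht y hy => by nlinarith [h0 (K - k) t, hy.1])
    (fun k t ht y hy => by nlinarith [h0 (K - k) t, hy.2]) (fun k => hp _)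
  refine ⟨fun k => X (K + 1 - k), fun t => by simp [hX0], fun k => hXc _, fun k t => hXm _ t,
    fun k hk => ?_, fun k hk t ht => ?_⟩
  · have := hXi (K - k)
    rwa [← Nat.sub_add_comm hk, Nat.sub_sub_self hk] at this
  · have := hXd (K - k) t ht
    rw [← Nat.sub_add_comm hk, Nat.sub_sub_self hk] at this
    simpa using this

namespace IsTailChain

variable {K : ℕ} {T : ℝ} {lam lam' : ℕ → ℝ → ℝ} {p : ℕ → ℝ} {P P' : ℕ → ℝ → ℝ}

theorem hasDerivWithinAt_diff (hP : IsTailChain K T lam p P) {k : ℕ} (hk : k < K) {t : ℝ}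
    (ht : t ∈ Icc 0 T) :
    HasDerivWithinAt (fun s => P k s - P (k + 1) s)
      (lam (k + 1) t * (P (k + 1) t - P (k + 2) t) - lam k t * (P k t - P (k + 1) t))
      (Icc 0 T) t :=
  ((hP.deriv k hk.le t ht).sub (hP.deriv (k + 1) hk t ht)).congr_deriv (by ring)

theorem anti (hP : IsTailChain K T lam p P) (h0 : ∀ k t, 0 ≤ lam k t)
    (hp : ∀ k, p (k + 1) ≤ p k) {k : ℕ} (hk : k ≤ K) :
    ∀ t ∈ Icc 0 T, P (k + 1) t ≤ P k t := by
  induction hk using Nat.decreasingInduction with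
  | self => intro t _; rw [hP.top]; exact (hP.mem K t).1
  | of_succ k hk ih =>
    suffices ∀ t ∈ Icc 0 T, -(P k t - P (k + 1) t) ≤ 0 from fun t ht => by linarith [this t ht]
    refine nonpos_of_deriv_nonpos_of_pos (fun t ht => (hP.hasDerivWithinAt_diff hk ht).neg) ?_
      fun t ht hpos => ?_
    · rw [hP.initial k hk.le, hP.initial (k + 1) hk]; linarith [hp k]
    · have := mul_nonneg (h0 (k + 1) t) (sub_nonneg.2 (ih t ht))
      have := mul_nonneg (h0 k t) hpos.le
      linarith

/-- Above the barrier the gap at `k` exceeds the one at `k + 1`, so transport by `lam` shrinks it.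
Only the source `(lam' - lam) * m'_k ≤ d` remains, and it is integrated in time. -/
theorem sub_le_time (hP : IsTailChain K T lam p P) (hP' : IsTailChain K T lam' p P')
    (h0 : ∀ k t, 0 ≤ lam k t) (h0' : ∀ k t, 0 ≤ lam' k t) (hp : ∀ k, p (k + 1) ≤ p k) {d : ℝ}
    (hd : ∀ k, 1 ≤ k → k ≤ K → ∀ t ∈ Icc 0 T, |lam k t - lam' k t| ≤ d) (hd0 : 0 ≤ d)
    {k : ℕ} (hk : k ≤ K + 1) (hk1 : 1 ≤ k) :
    ∀ t ∈ Icc 0 T, P k t - P' k t ≤ (K + 1 - k) * (t * d) := by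
  induction hk using Nat.decreasingInduction with
  | self => intro t _; simp [hP.top, hP'.top]
  | of_succ k hk ih =>
    have hkK : k ≤ K := Nat.lt_succ_iff.1 hk
    have hkK' : (0 : ℝ) ≤ K - k := sub_nonneg.2 (by exact_mod_cast hkK)
    suffices ∀ t ∈ Icc 0 T, P k t - P' k t - t * ((K + 1 - k) * d) ≤ 0 from
      fun t ht => by linarith [this t ht]
    refine nonpos_of_deriv_nonpos_of_pos
      (fun t ht => ((hP.deriv k hkK t ht).sub (hP'.deriv k hkK t ht)).sub
        ((hasDerivWithinAt_id t _).mul_const _))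
      (by simp [hP.initial k hkK, hP'.initial k hkK]) fun t ht hpos => ?_
    have hih := ih (by omega) t ht
    push_cast at hih
    have htd : 0 ≤ t * d := mul_nonneg ht.1 hd0
    have hm0 := sub_nonneg.2 (hP'.anti h0' hp hkK t ht)
    have hm1 : P' k t - P' (k + 1) t ≤ 1 := by linarith [(hP'.mem k t).2, (hP'.mem (k + 1) t).1]
    have h1 : 0 ≤ lam k t * ((P k t - P' k t) - (P (k + 1) t - P' (k + 1) t)) :=
      mul_nonneg (h0 k t) (by linarith)
    have h2 : -(lam k t - lam' k t) * (P' k t - P' (k + 1) t) ≤ d * 1 :=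
      mul_le_mul ((neg_le_abs _).trans (hd k hk1 hkK t ht)) hm1 hm0 hd0
    have h3 : 0 ≤ (K - k) * d := mul_nonneg hkK' hd0
    linarith

/-- Rates bounded below give damping: when the gaps at `k` and `k + 1` differ by `d / c`, transport
at rate at least `c` absorbs the source `d`. No factor of time appears. -/
theorem sub_le_of_rate_ge (hP : IsTailChain K T lam p P) (hP' : IsTailChain K T lam' p P')
    (h0' : ∀ k t, 0 ≤ lam' k t) (hp : ∀ k, p (k + 1) ≤ p k) {c d : ℝ} (hc : 0 < c)
    (h0 : ∀ k, 1 ≤ k → k ≤ K → ∀ t ∈ Icc 0 T, c ≤ lam k t)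
    (hd : ∀ k, 1 ≤ k → k ≤ K → ∀ t ∈ Icc 0 T, |lam k t - lam' k t| ≤ d) (hd0 : 0 ≤ d)
    {k : ℕ} (hk : k ≤ K + 1) (hk1 : 1 ≤ k) :
    ∀ t ∈ Icc 0 T, P k t - P' k t ≤ (K + 1 - k) * (d / c) := by
  have hdc0 : 0 ≤ d / c := div_nonneg hd0 hc.le
  induction hk using Nat.decreasingInduction with
  | self => intro t _; simp [hP.top, hP'.top]
  | of_succ k hk ih =>
    have hkK : k ≤ K := Nat.lt_succ_iff.1 hk
    have hkK' : (0 : ℝ) ≤ K - k := sub_nonneg.2 (by exact_mod_cast hkK)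
    have hkd : 0 ≤ (K - k) * (d / c) := mul_nonneg hkK' hdc0
    suffices ∀ t ∈ Icc 0 T, P k t - P' k t - (K + 1 - k) * (d / c) ≤ 0 from
      fun t ht => by linarith [this t ht]
    refine nonpos_of_deriv_nonpos_of_pos
      (fun t ht => ((hP.deriv k hkK t ht).sub (hP'.deriv k hkK t ht)).sub_const _)
      (by simp only [hP.initial k hkK, hP'.initial k hkK]; linarith) fun t ht hpos => ?_
    have hih := ih (by omega) t ht
    push_cast at hih
    have hm0 := sub_nonneg.2 (hP'.anti h0' hp hkK t ht)
    have hm1 : P' k t - P' (k + 1) t ≤ 1 := by linarith [(hP'.mem k t).2, (hP'.mem (k + 1) t).1]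
    have h1 : c * (d / c) ≤ lam k t * ((P k t - P' k t) - (P (k + 1) t - P' (k + 1) t)) :=
      mul_le_mul (h0 k hk1 hkK t ht) (by linarith) hdc0 (hc.le.trans (h0 k hk1 hkK t ht))
    have h2 : -(lam k t - lam' k t) * (P' k t - P' (k + 1) t) ≤ d * 1 :=
      mul_le_mul ((neg_le_abs _).trans (hd k hk1 hkK t ht)) hm1 hm0 hd0
    rw [mul_div_cancel₀ _ hc.ne'] at h1
    linarith

end IsTailChain

/-! ### The price path generated by values and an inventory distribution -/

/-- `1 + ε φ_ε(v, μ)` in closed form. -/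
noncomputable def aggregate (K : ℕ) (ε : ℝ) (v μ : ℕ → ℝ) : ℝ :=
  (2 + ε * ∑ k ∈ Finset.Icc 1 K, μ k * bdiff v k) / (2 + ε * activeMass K μ)

theorem one_add_phi {K : ℕ} {ε : ℝ} {v μ : ℕ → ℝ} (h : 2 + ε * activeMass K μ ≠ 0) :
    1 + ε * phi K ε v μ = aggregate K ε v μ := by
  unfold phi aggregate
  field_simp
  ring

section aggregate

variable {K : ℕ} {ε : ℝ} {v v' μ μ' : ℕ → ℝ}

theorem activeMass_nonneg (hμ : ∀ k ∈ Finset.Icc 1 K, 0 ≤ μ k) : 0 ≤ activeMass K μ :=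
  Finset.sum_nonneg hμ

theorem aggregate_le_one (hε : 0 ≤ ε) (hμ : ∀ k ∈ Finset.Icc 1 K, 0 ≤ μ k)
    (hv : ∀ k ∈ Finset.Icc 1 K, bdiff v k ≤ 1) : aggregate K ε v μ ≤ 1 := by
  have hη := activeMass_nonneg hμ
  have h : ∑ k ∈ Finset.Icc 1 K, μ k * bdiff v k ≤ activeMass K μ :=
    Finset.sum_le_sum fun k hk => mul_le_of_le_one_right (hμ k hk) (hv k hk)
  exact div_le_one_of_le₀ (by nlinarith) (by positivity)

theorem le_aggregate (hε : 0 ≤ ε) (hμ : ∀ k ∈ Finset.Icc 1 K, 0 ≤ μ k)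
    (hμ1 : activeMass K μ ≤ 1) (hv : ∀ k ∈ Finset.Icc 1 K, 0 ≤ bdiff v k) :
    2 / (2 + ε) ≤ aggregate K ε v μ := by
  have hη := activeMass_nonneg hμ
  have h : 0 ≤ ∑ k ∈ Finset.Icc 1 K, μ k * bdiff v k :=
    Finset.sum_nonneg fun k hk => mul_nonneg (hμ k hk) (hv k hk)
  unfold aggregate
  gcongr
  · nlinarith
  · nlinarith

/-- Inserting the equation `g * (2 + ε η') = 2 + ε ∑ μ'_k Δv'_k` for the second aggregate `g`
combines the changes of numerator and denominator into the weights `Δv_k - g`. These are at most `1`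
in modulus, as both terms lie in `[0, 1]`. -/
theorem abs_aggregate_sub_le (hε : 0 ≤ ε) (hμ : ∀ k ∈ Finset.Icc 1 K, 0 ≤ μ k)
    (hμ' : ∀ k ∈ Finset.Icc 1 K, 0 ≤ μ' k) (hμ1 : activeMass K μ' ≤ 1)
    (hv : ∀ k ∈ Finset.Icc 1 K, bdiff v k ∈ Icc (0 : ℝ) 1)
    (hv' : ∀ k ∈ Finset.Icc 1 K, bdiff v' k ∈ Icc (0 : ℝ) 1) {A δ : ℝ}
    (hA : ∀ k ∈ Finset.Icc 1 K, |μ k - μ' k| ≤ A)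
    (hδ : ∀ k ∈ Finset.Icc 1 K, |bdiff v k - bdiff v' k| ≤ δ) (hδ0 : 0 ≤ δ) :
    |aggregate K ε v μ - aggregate K ε v' μ'| ≤ ε / 2 * (K * A + δ) := by
  have hη := activeMass_nonneg hμ
  have hη' := activeMass_nonneg hμ'
  have hg1 := aggregate_le_one hε hμ' fun k hk => (hv' k hk).2
  have hg0 : 0 ≤ aggregate K ε v' μ' :=
    le_trans (by positivity) (le_aggregate hε hμ' hμ1 fun k hk => (hv' k hk).1)
  have hden : 0 < 2 + ε * activeMass K μ := by positivity
  have hden' : 0 < 2 + ε * activeMass K μ' := by positivity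
  have hg : aggregate K ε v' μ' * (2 + ε * activeMass K μ') =
      2 + ε * ∑ k ∈ Finset.Icc 1 K, μ' k * bdiff v' k := div_mul_cancel₀ _ hden'.ne'
  set g := aggregate K ε v' μ'
  have hsum : |∑ k ∈ Finset.Icc 1 K, ((μ k - μ' k) * (bdiff v k - g)
      + μ' k * (bdiff v k - bdiff v' k))| ≤ K * A + δ := by
    refine (Finset.abs_sum_le_sum_abs _ _).trans ?_
    calc _ ≤ ∑ k ∈ Finset.Icc 1 K, (A + μ' k * δ) := by
          refine Finset.sum_le_sum fun k hk => (abs_add_le _ _).trans ?_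
          rw [abs_mul, abs_mul, abs_of_nonneg (hμ' k hk)]
          have h1 : |bdiff v k - g| ≤ 1 :=
            abs_le.2 ⟨by linarith [(hv k hk).1], by linarith [(hv k hk).2]⟩
          have h2 := mul_le_mul (hA k hk) h1 (abs_nonneg _) ((abs_nonneg _).trans (hA k hk))
          have h3 := mul_le_mul_of_nonneg_left (hδ k hk) (hμ' k hk)
          linarith
      _ = K * A + activeMass K μ' * δ := by
          rw [Finset.sum_add_distrib, ← Finset.sum_mul, activeMass]; simp
      _ ≤ K * A + δ := by nlinarith
  have hkey : aggregate K ε v μ - g = ε * (∑ k ∈ Finset.Icc 1 K, ((μ k - μ' k) * (bdiff v k - g)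
      + μ' k * (bdiff v k - bdiff v' k))) / (2 + ε * activeMass K μ) := by
    rw [eq_div_iff hden.ne', sub_mul, aggregate, div_mul_cancel₀ _ hden.ne']
    have e : ∑ k ∈ Finset.Icc 1 K, ((μ k - μ' k) * (bdiff v k - g)
        + μ' k * (bdiff v k - bdiff v' k)) = ∑ k ∈ Finset.Icc 1 K, μ k * bdiff v k
        - ∑ k ∈ Finset.Icc 1 K, μ' k * bdiff v' k - g * (activeMass K μ - activeMass K μ') := by
      unfold activeMass
      rw [← Finset.sum_sub_distrib, ← Finset.sum_sub_distrib, Finset.mul_sum,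
        ← Finset.sum_sub_distrib]
      exact Finset.sum_congr rfl fun k _ => by ring
    rw [e]
    linear_combination -hg
  have h2 : 2 ≤ 2 + ε * activeMass K μ := by nlinarith
  rw [hkey, abs_div, abs_mul, abs_of_nonneg hε, abs_of_pos hden, div_le_iff₀ hden]
  have h4 := mul_le_mul_of_nonneg_left hsum hε
  have h5 : 0 ≤ ε / 2 * (K * A + δ) := mul_nonneg (by positivity) ((abs_nonneg _).trans hsum)
  nlinarith

end aggregate

/-! ### The response to a price path -/

/-- The sales rates `λ_k` at time `t`, for values `U` in the time to go, truncated at `0`. -/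
noncomputable def salesRate (T : ℝ) (b : ℝ → ℝ) (U : ℕ → ℝ → ℝ) (k : ℕ) (t : ℝ) : ℝ :=
  max (b t - bdiff (fun j => U j (T - t)) k) 0 / 2

/-- The inventory distribution with tails `P`. -/
noncomputable def tailMass (P : ℕ → ℝ → ℝ) (k : ℕ) (t : ℝ) : ℝ :=
  if k = 0 then 1 - P 1 t else P k t - P (k + 1) t

/-- `U` and `P` are the values and the tails of the inventory distribution in response to the path
`b` of `1 + ε φ`. -/
structure IsResponse (K : ℕ) (r T : ℝ) (M : ℕ → ℝ) (b : ℝ → ℝ) (U P : ℕ → ℝ → ℝ) : Prop where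
  value : IsValueChain r T (fun t => b (T - t)) U
  tail : IsTailChain K T (salesRate T b U) (fun k => ∑ i ∈ Finset.Icc k K, M i) P

theorem tailMass_of_pos (P : ℕ → ℝ → ℝ) {k : ℕ} (hk : 1 ≤ k) (t : ℝ) :
    tailMass P k t = P k t - P (k + 1) t := if_neg (by omega)

/-- Telescoping from `1 - P 1`. The mass at `0` is not `P 0 - P 1`, because in `IsTailChain` even `P
0` is transported and need not stay equal to the total mass. -/
theorem sum_tailMass (P : ℕ → ℝ → ℝ) (n : ℕ) (t : ℝ) :
    ∑ k ∈ Finset.range (n + 1), tailMass P k t = 1 - P (n + 1) t := by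
  induction n with
  | zero => simp [tailMass]
  | succ n ih => rw [Finset.sum_range_succ, ih, tailMass_of_pos P (by omega)]; ring

theorem activeMass_tailMass (P : ℕ → ℝ → ℝ) (n : ℕ) (t : ℝ) :
    activeMass n (fun k => tailMass P k t) = P 1 t - P (n + 1) t := by
  unfold activeMass
  induction n with
  | zero => simp
  | succ n ih => rw [Finset.sum_Icc_succ_top (by omega), ih, tailMass_of_pos P (by omega)]; ring

theorem salesRate_nonneg (T : ℝ) (b : ℝ → ℝ) (U : ℕ → ℝ → ℝ) (k : ℕ) (t : ℝ) :
    0 ≤ salesRate T b U k t := div_nonneg (le_max_right _ _) zero_le_two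

theorem sub_mem_Icc {T t : ℝ} (ht : t ∈ Icc 0 T) : T - t ∈ Icc 0 T :=
  ⟨by linarith [ht.2], by linarith [ht.1]⟩

section tails

variable {K : ℕ} {M : ℕ → ℝ}

theorem tail_succ_le (hM : ∀ k, k ≤ K → 0 ≤ M k) (k : ℕ) :
    ∑ i ∈ Finset.Icc (k + 1) K, M i ≤ ∑ i ∈ Finset.Icc k K, M i :=
  Finset.sum_le_sum_of_subset_of_nonneg (Finset.Icc_subset_Icc_left k.le_succ)
    fun i hi _ => hM i (Finset.mem_Icc.1 hi).2

theorem tail_mem_Icc (hM : ∀ k, k ≤ K → 0 ≤ M k) (hM1 : ∑ k ∈ Finset.range (K + 1), M k = 1)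
    (k : ℕ) : ∑ i ∈ Finset.Icc k K, M i ∈ Icc (0 : ℝ) 1 := by
  refine ⟨Finset.sum_nonneg fun i hi => hM i (Finset.mem_Icc.1 hi).2, ?_⟩
  rw [← hM1]
  refine Finset.sum_le_sum_of_subset_of_nonneg (fun i hi => ?_) fun i hi _ => ?_
  · have := (Finset.mem_Icc.1 hi).2
    exact Finset.mem_range.2 (by omega)
  · exact hM i (by have := Finset.mem_range.1 hi; omega)

end tails

theorem bdiff_value_mem_Icc {r T : ℝ} (hr : 0 < r) {c : ℝ → ℝ} {U : ℕ → ℝ → ℝ}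
    (hU : IsValueChain r T c U) (hc : ∀ t, c t ≤ 1) (k : ℕ) {t : ℝ} (ht : t ∈ Icc 0 T) :
    bdiff (fun j => U j (T - t)) k ∈ Icc (0 : ℝ) 1 := by
  cases k with
  | zero => simp [bdiff]
  | succ k =>
    exact ⟨hU.diff_nonneg hr k _ (sub_mem_Icc ht), hU.diff_le_one hr hc k _ (sub_mem_Icc ht)⟩

theorem exists_isResponse {K : ℕ} {r T : ℝ} (hr : 0 < r) (hT : 0 ≤ T) {M : ℕ → ℝ}
    (hM : ∀ k, k ≤ K → 0 ≤ M k) (hM1 : ∑ k ∈ Finset.range (K + 1), M k = 1) {b : ℝ → ℝ}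
    (hb : Continuous b) (hb1 : ∀ t, b t ≤ 1) : ∃ U P, IsResponse K r T M b U P := by
  obtain ⟨U, hU⟩ := exists_isValueChain hr hT (b := fun t => b (T - t)) (by fun_prop)
    fun t => hb1 _
  obtain ⟨P, hP⟩ := exists_isTailChain (K := K) hT (lam := salesRate T b U)
    (fun k => by
      have h1 := hU.continuous k
      have h2 := hU.continuous (k - 1)
      unfold salesRate bdiff
      fun_prop)
    (fun k t => salesRate_nonneg T b U k t)
    (fun k t ht => by
      have := (bdiff_value_mem_Icc hr hU (fun t => hb1 _) k ht).1
      have : max (b t - bdiff (fun j => U j (T - t)) k) 0 ≤ 1 :=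
        max_le (by linarith [hb1 t]) zero_le_one
      unfold salesRate
      linarith)
    (fun k => tail_mem_Icc hM hM1 k)
  exact ⟨U, P, hU, hP⟩

namespace IsResponse

variable {K : ℕ} {r T ε : ℝ} {M : ℕ → ℝ} {b b' : ℝ → ℝ} {U U' P P' : ℕ → ℝ → ℝ}

theorem tailMass_nonneg (h : IsResponse K r T M b U P) (hM : ∀ k, k ≤ K → 0 ≤ M k) {k : ℕ}
    (hk : k ≤ K) {t : ℝ} (ht : t ∈ Icc 0 T) : 0 ≤ tailMass P k t := by
  unfold tailMass
  split_ifs with h0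
  · linarith [(h.tail.mem 1 t).2]
  · linarith [h.tail.anti (salesRate_nonneg T b U) (tail_succ_le hM) hk t ht]

theorem continuous_aggregate (h : IsResponse K r T M b U P) (hε : 0 ≤ ε)
    (hM : ∀ k, k ≤ K → 0 ≤ M k) :
    ContinuousOn (fun t => aggregate K ε (fun j => U j (T - t)) (fun j => tailMass P j t))
      (Icc 0 T) := by
  have hU := h.value.continuous
  have hP : ∀ k, Continuous (tailMass P k) := fun k => by
    have h1 := h.tail.continuous 1
    have h2 := h.tail.continuous k
    have h3 := h.tail.continuous (k + 1)
    unfold tailMass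
    split_ifs <;> fun_prop
  refine ContinuousOn.div ?_ ?_ fun t ht => ?_
  · unfold bdiff
    fun_prop
  · unfold activeMass
    fun_prop
  · have := activeMass_nonneg (K := K) (μ := fun j => tailMass P j t)
      fun k hk => h.tailMass_nonneg hM (Finset.mem_Icc.1 hk).2 ht
    positivity

theorem aggregate_mem (h : IsResponse K r T M b U P) (hr : 0 < r) (hε : 0 ≤ ε)
    (hM : ∀ k, k ≤ K → 0 ≤ M k) (hb1 : ∀ t, b t ≤ 1) {t : ℝ} (ht : t ∈ Icc 0 T) :
    aggregate K ε (fun j => U j (T - t)) (fun j => tailMass P j t) ∈ Icc (2 / (2 + ε)) 1 := by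
  have hμ : ∀ k ∈ Finset.Icc 1 K, 0 ≤ tailMass P k t :=
    fun k hk => h.tailMass_nonneg hM (Finset.mem_Icc.1 hk).2 ht
  have hv := fun k => bdiff_value_mem_Icc hr h.value (fun t => hb1 _) k ht
  refine ⟨le_aggregate hε hμ ?_ fun k _ => (hv k).1, aggregate_le_one hε hμ fun k _ => (hv k).2⟩
  rw [activeMass_tailMass, h.tail.top, sub_zero]
  exact (h.tail.mem 1 t).2

theorem abs_aggregate_sub_le (h : IsResponse K r T M b U P) (h' : IsResponse K r T M b' U' P')
    (hr : 0 < r) (hε : 0 ≤ ε) (hM : ∀ k, k ≤ K → 0 ≤ M k) (hb1 : ∀ t, b t ≤ 1)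
    (hb1' : ∀ t, b' t ≤ 1) {t c δ : ℝ} (ht : t ∈ Icc 0 T) (hc0 : 0 ≤ c) (hδ0 : 0 ≤ δ)
    (hc : ∀ k, 1 ≤ k → k ≤ K + 1 → |P k t - P' k t| ≤ (K + 1 - k) * c)
    (hδ : ∀ k, |U k (T - t) - U' k (T - t)| ≤ k * δ) :
    |aggregate K ε (fun j => U j (T - t)) (fun j => tailMass P j t)
      - aggregate K ε (fun j => U' j (T - t)) (fun j => tailMass P' j t)|
      ≤ ε * (K ^ 2 * c + K * δ) := by
  refine (InventoryMFG.abs_aggregate_sub_le (A := 2 * K * c) (δ := 2 * K * δ) hε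
    (fun k hk => h.tailMass_nonneg hM (Finset.mem_Icc.1 hk).2 ht)
    (fun k hk => h'.tailMass_nonneg hM (Finset.mem_Icc.1 hk).2 ht) ?_
    (fun k _ => bdiff_value_mem_Icc hr h.value (fun t => hb1 _) k ht)
    (fun k _ => bdiff_value_mem_Icc hr h'.value (fun t => hb1' _) k ht)
    (fun k hk => ?_) (fun k hk => ?_) (by positivity)).trans_eq (by ring)
  · rw [activeMass_tailMass, h'.tail.top, sub_zero]
    exact (h'.tail.mem 1 t).2
  · obtain ⟨hk1, hkK⟩ := Finset.mem_Icc.1 hk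
    have e : tailMass P k t - tailMass P' k t
        = (P k t - P' k t) - (P (k + 1) t - P' (k + 1) t) := by
      rw [tailMass_of_pos P hk1, tailMass_of_pos P' hk1]; ring
    have h1 := hc k hk1 (by omega)
    have h2 := hc (k + 1) (by omega) (by omega)
    push_cast at h2
    have h3 : (1 : ℝ) ≤ k := by exact_mod_cast hk1
    rw [e]
    refine (abs_sub _ _).trans ?_
    nlinarith
  · obtain ⟨hk1, hkK⟩ := Finset.mem_Icc.1 hk
    have h1 := hδ k
    have h2 := hδ (k - 1)
    rw [Nat.cast_sub hk1, Nat.cast_one] at h2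
    have h3 : (k : ℝ) ≤ K := by exact_mod_cast hkK
    have e : bdiff (fun j => U j (T - t)) k - bdiff (fun j => U' j (T - t)) k
        = (U k (T - t) - U' k (T - t)) - (U (k - 1) (T - t) - U' (k - 1) (T - t)) := by
      unfold bdiff; ring
    rw [e]
    refine (abs_sub _ _).trans ?_
    nlinarith

theorem abs_value_sub_le (h : IsResponse K r T M b U P) (h' : IsResponse K r T M b' U' P')
    (hr : 0 < r) {β : ℝ} (hβ0 : 0 ≤ β) (hβ : ∀ t ∈ Icc 0 T, |b t - b' t| ≤ β) (k : ℕ) {t : ℝ}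
    (ht : t ∈ Icc 0 T) : |U k (T - t) - U' k (T - t)| ≤ k * β := by
  have ht' := sub_mem_Icc ht
  refine abs_sub_le_iff.2 ⟨h.value.sub_le_nat_mul h'.value hr (fun s hs => ?_) hβ0 k _ ht',
    h'.value.sub_le_nat_mul h.value hr (fun s hs => ?_) hβ0 k _ ht'⟩
  · exact (abs_sub_le_iff.1 (hβ _ (sub_mem_Icc hs))).1
  · exact (abs_sub_le_iff.1 (hβ _ (sub_mem_Icc hs))).2

theorem abs_value_sub_le_time (h : IsResponse K r T M b U P) (h' : IsResponse K r T M b' U' P')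
    (hr : 0 < r) (hb1 : ∀ t, b t ≤ 1) (hb1' : ∀ t, b' t ≤ 1) {β : ℝ} (hβ0 : 0 ≤ β)
    (hβ : ∀ t ∈ Icc 0 T, |b t - b' t| ≤ β) (k : ℕ) {t : ℝ}
    (ht : t ∈ Icc 0 T) : |U k (T - t) - U' k (T - t)| ≤ k * (T / 2 * β) := by
  have ht' := sub_mem_Icc ht
  have key : (k : ℝ) * ((T - t) / 2 * β) ≤ k * (T / 2 * β) := by
    have := ht.1
    gcongr
    linarith
  refine abs_sub_le_iff.2
    ⟨(h.value.sub_le_nat_mul_time h'.value hr (fun t => hb1 _) (fun s hs => ?_) hβ0 k _ ht').trans key,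
    (h'.value.sub_le_nat_mul_time h.value hr (fun t => hb1' _) (fun s hs => ?_) hβ0 k _ ht').trans key⟩
  · exact (abs_sub_le_iff.1 (hβ _ (sub_mem_Icc hs))).1
  · exact (abs_sub_le_iff.1 (hβ _ (sub_mem_Icc hs))).2

theorem abs_salesRate_sub_le (h : IsResponse K r T M b U P) (h' : IsResponse K r T M b' U' P')
    (hr : 0 < r) {β : ℝ} (hβ0 : 0 ≤ β) (hβ : ∀ t ∈ Icc 0 T, |b t - b' t| ≤ β) {k : ℕ} (hk1 : 1 ≤ k)
    (hk : k ≤ K) {t : ℝ} (ht : t ∈ Icc 0 T) :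
    |salesRate T b U k t - salesRate T b' U' k t| ≤ K * β := by
  have h1 := h.abs_value_sub_le h' hr hβ0 hβ k ht
  have h2 := h.abs_value_sub_le h' hr hβ0 hβ (k - 1) ht
  rw [Nat.cast_sub hk1, Nat.cast_one] at h2
  have h3 : (k : ℝ) * β ≤ K * β := by gcongr
  have h4 := hβ t ht
  -- The contributions are `β + k * β + (k - 1) * β = 2 * k * β`.
  have h5 : |(b t - bdiff (fun j => U j (T - t)) k) - (b' t - bdiff (fun j => U' j (T - t)) k)|
      ≤ 2 * (K * β) := by
    unfold bdiff
    rw [abs_le] at *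
    constructor <;> linarith
  unfold salesRate
  rw [← sub_div, abs_div, abs_two, div_le_iff₀ two_pos]
  exact (abs_max_sub_max_le_abs _ _ _).trans (by linarith)

theorem contraction_of_horizon (h : IsResponse K r T M b U P) (h' : IsResponse K r T M b' U' P')
    (hr : 0 < r) (hε : 0 ≤ ε) (hM : ∀ k, k ≤ K → 0 ≤ M k) (hb1 : ∀ t, b t ≤ 1)
    (hb1' : ∀ t, b' t ≤ 1) {β : ℝ} (hβ0 : 0 ≤ β) (hβ : ∀ t ∈ Icc 0 T, |b t - b' t| ≤ β)
    (hK : 1 ≤ K) (hsmall : ε * T * K ^ 3 ≤ 1 / 3) {t : ℝ} (ht : t ∈ Icc 0 T) :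
    |aggregate K ε (fun j => U j (T - t)) (fun j => tailMass P j t)
      - aggregate K ε (fun j => U' j (T - t)) (fun j => tailMass P' j t)| ≤ 1 / 2 * β := by
  have hT : 0 ≤ T := ht.1.trans ht.2
  have hKβ : 0 ≤ K * β := by positivity
  have hrate := fun k hk1 hk t ht => h.abs_salesRate_sub_le h' hr hβ0 hβ (k := k) hk1 hk (t := t) ht
  have hrate' := fun k hk1 hk t ht =>
    (abs_sub_comm _ _).trans_le (h.abs_salesRate_sub_le h' hr hβ0 hβ (k := k) hk1 hk (t := t) ht)
  refine (h.abs_aggregate_sub_le h' (c := T * (K * β)) (δ := T / 2 * β) hr hε hM hb1 hb1' ht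
    (by positivity) (by positivity) (fun k hk1 hk => ?_)
    fun k => h.abs_value_sub_le_time h' hr hb1 hb1' hβ0 hβ k ht).trans ?_
  · have hkK : (0 : ℝ) ≤ K + 1 - k := sub_nonneg.2 (by exact_mod_cast hk)
    have key : (K + 1 - k) * (t * (K * β)) ≤ (K + 1 - k) * (T * (K * β)) := by
      gcongr
      exact ht.2
    exact abs_sub_le_iff.2
      ⟨(h.tail.sub_le_time h'.tail (salesRate_nonneg T b U) (salesRate_nonneg T b' U')
        (tail_succ_le hM) hrate hKβ hk hk1 t ht).trans key,
      (h'.tail.sub_le_time h.tail (salesRate_nonneg T b' U') (salesRate_nonneg T b U)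
        (tail_succ_le hM) hrate' hKβ hk hk1 t ht).trans key⟩
  · have h1 : (1 : ℝ) ≤ K := by exact_mod_cast hK
    have h3 : (K : ℝ) ≤ K ^ 3 := le_self_pow₀ h1 (by norm_num)
    have h4 : ε * T * K ≤ ε * T * K ^ 3 := by gcongr
    -- The tails give at most `1 / 3` and the values at most `1 / 6`.
    calc _ = (ε * T * K ^ 3 + ε * T * K / 2) * β := by ring
      _ ≤ _ := by
        gcongr
        linarith

theorem contraction_of_rate_ge (h : IsResponse K r T M b U P) (h' : IsResponse K r T M b' U' P')
    (hr : 0 < r) (hε : 0 ≤ ε) (hM : ∀ k, k ≤ K → 0 ≤ M k) (hb1 : ∀ t, b t ≤ 1)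
    (hb1' : ∀ t, b' t ≤ 1) {β : ℝ} (hβ0 : 0 ≤ β) (hβ : ∀ t ∈ Icc 0 T, |b t - b' t| ≤ β)
    (hK : 1 ≤ K) (hsmall : 10 * ε * K ^ 3 ≤ 1)
    (hge : ∀ k, 1 ≤ k → k ≤ K → ∀ t ∈ Icc 0 T, 1 / 4 ≤ salesRate T b U k t)
    (hge' : ∀ k, 1 ≤ k → k ≤ K → ∀ t ∈ Icc 0 T, 1 / 4 ≤ salesRate T b' U' k t)
    {t : ℝ} (ht : t ∈ Icc 0 T) :
    |aggregate K ε (fun j => U j (T - t)) (fun j => tailMass P j t)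
      - aggregate K ε (fun j => U' j (T - t)) (fun j => tailMass P' j t)| ≤ 1 / 2 * β := by
  have hKβ : 0 ≤ K * β := by positivity
  have hrate := fun k hk1 hk t ht => h.abs_salesRate_sub_le h' hr hβ0 hβ (k := k) hk1 hk (t := t) ht
  have hrate' := fun k hk1 hk t ht =>
    (abs_sub_comm _ _).trans_le (h.abs_salesRate_sub_le h' hr hβ0 hβ (k := k) hk1 hk (t := t) ht)
  refine (h.abs_aggregate_sub_le h' (c := K * β / (1 / 4)) (δ := β) hr hε hM hb1 hb1' ht
    (by positivity) (by positivity) (fun k hk1 hk => ?_)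
    fun k => h.abs_value_sub_le h' hr hβ0 hβ k ht).trans ?_
  · exact abs_sub_le_iff.2
      ⟨h.tail.sub_le_of_rate_ge h'.tail (salesRate_nonneg T b' U')
        (tail_succ_le hM) (by norm_num) hge hrate hKβ hk hk1 t ht,
      h'.tail.sub_le_of_rate_ge h.tail (salesRate_nonneg T b U)
        (tail_succ_le hM) (by norm_num) hge' hrate' hKβ hk hk1 t ht⟩
  · have h1 : (1 : ℝ) ≤ K := by exact_mod_cast hK
    have h3 : (K : ℝ) ≤ K ^ 3 := le_self_pow₀ h1 (by norm_num)
    have h4 : ε * K ≤ ε * K ^ 3 := by gcongr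
    calc _ = (4 * (ε * K ^ 3) + ε * K) * β := by ring
      _ ≤ _ := by
        gcongr
        linarith

end IsResponse

/-! ### The smallness condition -/

theorem sq_le_two_mul_two_pow (K : ℕ) : K ^ 2 ≤ 2 * 2 ^ K := by
  induction K with
  | zero => norm_num
  | succ n ih =>
    have : n + 1 ≤ 2 ^ n := Nat.lt_two_pow_self
    rw [pow_succ 2]
    nlinarith

/-- Below `C₁`, either the interaction is small over the whole horizon, or discounting is strong and
the interaction is small. -/
theorem horizon_small_or_discount_large {K : ℕ} (hK : 1 ≤ K) {r T ε : ℝ} (hT : 0 < T)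
    (hεC : ε < C₁ K T r) :
    ε * T * K ^ 3 ≤ 1 / 3 ∨ (1 ≤ r ∧ 10 * ε * K ^ 3 ≤ 1) := by
  refine or_iff_not_imp_left.2 fun hlarge => ?_
  rw [not_le] at hlarge
  have hK1 : (1 : ℝ) ≤ K := by exact_mod_cast hK
  have hpos : (0 : ℝ) < K ^ 2 * T * 2 ^ (K + 8) := by positivity
  have hmin : ε * (K ^ 2 * T * 2 ^ (K + 8)) < min (1 + (K : ℝ) * T) (Real.sqrt r) := by
    rw [C₁, one_div_mul_eq_div, lt_div_iff₀ hpos] at hεC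
    exact hεC
  obtain ⟨hm1, hm2⟩ := lt_min_iff.1 hmin
  have hX1 : (256 : ℝ) * K ≤ 2 ^ (K + 8) := by
    have h : (K : ℝ) ≤ 2 ^ K := by exact_mod_cast (Nat.lt_two_pow_self (n := K)).le
    rw [pow_add]; linarith
  have hX2 : 20 * (K : ℝ) ^ 2 ≤ 2 ^ (K + 8) := by
    have h : (K : ℝ) ^ 2 ≤ 2 * 2 ^ K := by exact_mod_cast sq_le_two_mul_two_pow K
    rw [pow_add]; nlinarith [show (0 : ℝ) < 2 ^ K by positivity]
  set X : ℝ := 2 ^ (K + 8)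
  have hX0 : 0 < X := by positivity
  -- From `ε T K ^ 3 > 1 / 3` and `X ≥ 256 K`. Hence both terms of the minimum exceed `85`: `r` is
  -- large, and `1 + K T < 2 K T`.
  have hlow : K * 85 < ε * (K ^ 2 * T * X) * K := by nlinarith
  have hlow' : 85 < ε * (K ^ 2 * T * X) := by nlinarith
  constructor
  · refine (Real.one_le_sqrt).1 ?_
    linarith
  · have hKT : ε * (K ^ 2 * T * X) < 2 * (K * T) := by linarith
    have h1 : ε * (K * X) < 2 := by
      have : (ε * (K * X)) * (K * T) < 2 * (K * T) := by linarith
      exact lt_of_mul_lt_mul_right this (by positivity)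
    have h2 : (10 * ε * K ^ 3) * X ≤ 1 * X := by nlinarith [sq_nonneg (K : ℝ)]
    exact le_of_mul_le_mul_right h2 hX0

theorem IsResponse.bdiff_le_of_horizon {K : ℕ} {r T ε : ℝ} {M : ℕ → ℝ} {b : ℝ → ℝ}
    {U P : ℕ → ℝ → ℝ} (h : IsResponse K r T M b U P) (hr : 0 < r) (hε : 0 ≤ ε)
    (hεT : ε * T ≤ 8) (hb : ∀ t, b t ∈ Icc (2 / (2 + ε)) 1) {k : ℕ} (hk : 1 ≤ k) {t : ℝ}
    (ht : t ∈ Icc 0 T) : bdiff (fun j => U j (T - t)) k ≤ b t := by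
  obtain ⟨n, rfl⟩ := Nat.exists_eq_add_of_le' hk
  refine ((h.value.diff_le_div hr (fun t => (hb _).2) n _ (sub_mem_Icc ht)).trans ?_).trans (hb t).1
  obtain ⟨h0, h1⟩ := sub_mem_Icc ht
  -- With `s = T - t`, the inequality `s / (4 + s) ≤ 2 / (2 + ε)` says exactly `ε * s ≤ 8`.
  rw [div_le_div_iff₀ (by linarith) (by linarith)]
  nlinarith

theorem IsResponse.bdiff_add_half_le {K : ℕ} {r T ε : ℝ} {M : ℕ → ℝ} {b : ℝ → ℝ}
    {U P : ℕ → ℝ → ℝ} (h : IsResponse K r T M b U P) (hr : 1 ≤ r) (hε : 0 ≤ ε) (hε1 : 10 * ε ≤ 1)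
    (hb : ∀ t, b t ∈ Icc (2 / (2 + ε)) 1) {k : ℕ} (hk : 1 ≤ k) {t : ℝ} (ht : t ∈ Icc 0 T) :
    bdiff (fun j => U j (T - t)) k + 1 / 2 ≤ b t := by
  obtain ⟨n, rfl⟩ := Nat.exists_eq_add_of_le' hk
  have h1 : U (n + 1) (T - t) - U n (T - t) ≤ 1 / (4 * r) :=
    h.value.diff_le_inv (by linarith) (fun t => (hb _).2) n _ (sub_mem_Icc ht)
  have h2 : 1 / (4 * r) ≤ 1 / 4 := one_div_le_one_div_of_le (by norm_num) (by linarith)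
  have h3 : 3 / 4 ≤ 2 / (2 + ε) := by
    rw [div_le_div_iff₀ (by norm_num) (by linarith)]; linarith
  have h4 := (hb t).1
  simp only [bdiff, Nat.add_sub_cancel]
  linarith

/-! ### The equilibrium -/

/-- A price path that reproduces itself, by contraction. -/
theorem exists_fixed_response {K : ℕ} (hK : 1 ≤ K) {r T : ℝ} (hr : 0 < r) (hT : 0 < T)
    {M : ℕ → ℝ} (hM : ∀ k, k ≤ K → 0 ≤ M k) (hM1 : ∑ k ∈ Finset.range (K + 1), M k = 1)
    {ε : ℝ} (hε : 0 < ε) (hεC : ε < C₁ K T r) :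
    ∃ (b : ℝ → ℝ) (U P : ℕ → ℝ → ℝ), IsResponse K r T M b U P ∧
      (∀ t, b t ∈ Icc (2 / (2 + ε)) 1) ∧
      (∀ t ∈ Icc 0 T,
        b t = aggregate K ε (fun j => U j (T - t)) (fun j => tailMass P j t)) ∧
      ∀ k, 1 ≤ k → ∀ t ∈ Icc 0 T, bdiff (fun j => U j (T - t)) k ≤ b t := by
  have hlo : 2 / (2 + ε) ≤ 1 := div_le_one_of_le₀ (by linarith) (by linarith)
  -- Clamping lets the map act on the whole complete space `C([0, T])`, and is 1-Lipschitz. At a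
  -- fixed point it does nothing, by `aggregate_mem`.
  let ext : C(Icc (0 : ℝ) T, ℝ) → ℝ → ℝ := fun f t =>
    max (2 / (2 + ε)) (min 1 (f (projIcc 0 T hT.le t)))
  have hext_mem : ∀ f t, ext f t ∈ Icc (2 / (2 + ε)) 1 := fun f t =>
    ⟨le_max_left _ _, max_le hlo (min_le_left _ _)⟩
  have hext_cont : ∀ f, Continuous (ext f) := fun f =>
    continuous_const.max (continuous_const.min (f.continuous.comp continuous_projIcc))
  have hext_lip : ∀ f g t, |ext f t - ext g t| ≤ dist f g := fun f g t => by
    refine (abs_max_sub_max_le_max _ _ _ _).trans ?_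
    rw [sub_self, abs_zero]
    refine max_le dist_nonneg ((abs_min_sub_min_le_max _ _ _ _).trans ?_)
    rw [sub_self, abs_zero]
    exact max_le dist_nonneg (ContinuousMap.dist_apply_le_dist (f := f) (g := g) _)
  choose U P hR using fun f =>
    exists_isResponse hr hT.le hM hM1 (hext_cont f) fun t => (hext_mem f t).2
  have hcases : (∀ f, ∀ k, 1 ≤ k → ∀ t ∈ Icc 0 T,
        bdiff (fun j => U f j (T - t)) k ≤ ext f t) ∧
      ∀ f g, ∀ t ∈ Icc 0 T,
        |aggregate K ε (fun j => U f j (T - t)) (fun j => tailMass (P f) j t)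
          - aggregate K ε (fun j => U g j (T - t)) (fun j => tailMass (P g) j t)|
          ≤ 1 / 2 * dist f g := by
    have hK3 : (1 : ℝ) ≤ (K : ℝ) ^ 3 := one_le_pow₀ (by exact_mod_cast hK)
    rcases horizon_small_or_discount_large hK hT hεC with hA | ⟨hr1, hB⟩
    · have hεT : ε * T ≤ 8 := by
        have := mul_le_mul_of_nonneg_left hK3 (mul_pos hε hT).le
        linarith
      exact ⟨fun f k hk t ht => (hR f).bdiff_le_of_horizon hr hε.le hεT (hext_mem f) hk ht,
        fun f g t ht => (hR f).contraction_of_horizon (hR g) hr hε.le hM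
          (fun t => (hext_mem f t).2) (fun t => (hext_mem g t).2) dist_nonneg
          (fun t _ => hext_lip f g t) hK hA ht⟩
    · have hε1 : 10 * ε ≤ 1 := by nlinarith
      have hhalf := fun f k (hk : 1 ≤ k) t (ht : t ∈ Icc 0 T) =>
        (hR f).bdiff_add_half_le hr1 hε.le hε1 (hext_mem f) hk ht
      have hge : ∀ f k, 1 ≤ k → k ≤ K → ∀ t ∈ Icc 0 T, 1 / 4 ≤ salesRate T (ext f) (U f) k t := by
        intro f k hk _ t ht
        have h1 := hhalf f k hk t ht
        have h2 := le_max_left (ext f t - bdiff (fun j => U f j (T - t)) k) 0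
        unfold salesRate
        linarith
      exact ⟨fun f k hk t ht => by linarith [hhalf f k hk t ht],
        fun f g t ht => (hR f).contraction_of_rate_ge (hR g) hr hε.le hM
          (fun t => (hext_mem f t).2) (fun t => (hext_mem g t).2) dist_nonneg
          (fun t _ => hext_lip f g t) hK hB (hge f) (hge g) ht⟩
  let Φ : C(Icc (0 : ℝ) T, ℝ) → C(Icc (0 : ℝ) T, ℝ) := fun f =>
    ⟨fun t => aggregate K ε (fun j => U f j (T - t)) (fun j => tailMass (P f) j t),
      continuousOn_iff_continuous_domRestrict.1 ((hR f).continuous_aggregate hε.le hM)⟩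
  have hΦ : ContractingWith (1 / 2) Φ := by
    refine ⟨by norm_num, LipschitzWith.of_dist_le_mul fun f g => ?_⟩
    refine (ContinuousMap.dist_le (by positivity)).2 fun t => ?_
    exact (hcases.2 f g t t.2).trans_eq (by simp)
  obtain ⟨f, hf⟩ : ∃ f, Φ f = f := ⟨_, hΦ.fixedPoint_isFixedPt⟩
  refine ⟨ext f, U f, P f, hR f, hext_mem f, fun t ht => ?_, hcases.1 f⟩
  have h1 := (hR f).aggregate_mem hr hε.le hM (fun t => (hext_mem f t).2) ht
  have h2 : f ⟨t, ht⟩ = aggregate K ε (fun j => U f j (T - t)) (fun j => tailMass (P f) j t) := by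
    conv_lhs => rw [← hf]
    rfl
  simp only [ext, projIcc_of_mem hT.le ht, h2]
  rw [min_eq_right h1.2, max_eq_right h1.1]

theorem IsResponse.isSolution {K : ℕ} {r T ε : ℝ} {M : ℕ → ℝ} {b : ℝ → ℝ} {U P : ℕ → ℝ → ℝ}
    (h : IsResponse K r T M b U P) (hK : 1 ≤ K)
    (hM1 : ∑ k ∈ Finset.range (K + 1), M k = 1)
    (hphi : ∀ t ∈ Icc 0 T,
      1 + ε * phi K ε (fun j => U j (T - t)) (fun j => tailMass P j t) = b t)
    (hle : ∀ k, 1 ≤ k → ∀ t ∈ Icc 0 T, bdiff (fun j => U j (T - t)) k ≤ b t) :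
    IsSolution K r T ε M (fun k t => U k (T - t)) (tailMass P) := by
  have hrate : ∀ k, 1 ≤ k → ∀ t ∈ Icc 0 T,
      rate K ε (fun j => U j (T - t)) (fun j => tailMass P j t) k = salesRate T b U k t := by
    intro k hk t ht
    rw [rate, salesRate, max_eq_left (sub_nonneg.2 (hle k hk t ht)), ← hphi t ht]
    ring
  have htop : ∀ t, tailMass P K t = P K t := fun t => by
    rw [tailMass_of_pos P hK, h.tail.top, sub_zero]
  refine ⟨fun k hk1 hk t ht => ?_, fun k hk1 hk t ht => ?_, fun t ht => ?_, fun t ht => ?_,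
    fun t _ => h.value.zero _, fun k _ _ => ?_, fun k hk => ?_⟩
  · obtain ⟨n, rfl⟩ := Nat.exists_eq_add_of_le' hk1
    -- Reversing time turns the initial value problem for `U` into the terminal value problem for
    -- `V`.
    have hd := (h.value.deriv n (T - t) (sub_mem_Icc ht)).comp t
      ((hasDerivWithinAt_id t (Icc 0 T)).const_sub T) fun s hs => sub_mem_Icc hs
    refine hd.congr_deriv ?_
    have hD : bdiff (fun j => U j (T - t)) (n + 1) = U (n + 1) (T - t) - U n (T - t) := rfl
    have hn := hle (n + 1) hk1 t ht
    rw [sub_sub_cancel, ← hD, hamiltonian_of_nonneg (sub_nonneg.2 hn), ← hphi t ht]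
    ring
  · rw [hrate (k + 1) (by omega) t ht, hrate k hk1 t ht, tailMass_of_pos P hk1,
      tailMass_of_pos P (by omega : 1 ≤ k + 1)]
    exact (h.tail.hasDerivWithinAt_diff hk ht).congr (fun s _ => tailMass_of_pos P hk1 s)
      (tailMass_of_pos P hk1 t)
  · rw [hrate 1 le_rfl t ht, tailMass_of_pos P le_rfl]
    refine (((h.tail.deriv 1 hK t ht).const_sub 1).congr_deriv (by ring)).congr
      (fun s _ => if_pos rfl) (if_pos rfl)
  · rw [hrate K hK t ht, tailMass_of_pos P hK]
    exact (h.tail.deriv K le_rfl t ht).congr (fun s _ => htop s) (htop t)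
  · simp only [sub_self]
    exact h.value.initial k
  · have hstep : ∀ k, k ≤ K → ∑ i ∈ Finset.Icc k K, M i
        = M k + ∑ i ∈ Finset.Icc (k + 1) K, M i := fun k hk => by
      rw [← Finset.add_sum_Ioc_eq_sum_Icc hk, Finset.Icc_add_one_left_eq_Ioc]
    unfold tailMass
    split_ifs with h0
    · subst h0
      have h1 := hstep 0 hk
      rw [← Nat.range_succ_eq_Icc_zero, hM1, zero_add] at h1
      rw [h.tail.initial 1 hK]
      linarith
    · rw [h.tail.initial k hk]
      rcases hk.eq_or_lt with rfl | hlt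
      · rw [h.tail.top]; simp
      · rw [h.tail.initial (k + 1) hlt]
        linarith [hstep k hk]

end InventoryMFG

theorem theorem2p2 (K : ℕ) (hK : 1 ≤ K) (r T : ℝ) (hr : 0 < r) (hT : 0 < T)
    (M : ℕ → ℝ) (hM_nonneg : ∀ k, k ≤ K → 0 ≤ M k)
    (hM_sum : ∑ k ∈ Finset.range (K + 1), M k = 1)
    (ε : ℝ) (hε : 0 < ε) (hεC : ε < InventoryMFG.C₁ K T r) :
    ∃ V m : ℕ → ℝ → ℝ,
      InventoryMFG.IsSolution K r T ε M V m ∧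
      ∀ t ∈ Set.Icc 0 T,
        (∀ k, k ≤ K → 0 ≤ m k t) ∧
        ∑ k ∈ Finset.range (K + 1), m k t = 1 ∧
        ∀ k, 1 ≤ k → k ≤ K →
          0 ≤ InventoryMFG.rate K ε (fun j => V j t) (fun j => m j t) k ∧
          0 ≤ InventoryMFG.price K ε (fun j => V j t) (fun j => m j t) k := by
  obtain ⟨b, U, P, hR, hb, hfix, hle⟩ :=
    InventoryMFG.exists_fixed_response hK hr hT hM_nonneg hM_sum hε hεC
  have hphi : ∀ t ∈ Set.Icc 0 T, 1 + ε * InventoryMFG.phi K ε (fun j => U j (T - t))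
      (fun j => InventoryMFG.tailMass P j t) = b t := by
    intro t ht
    have := InventoryMFG.activeMass_nonneg (K := K) (μ := fun j => InventoryMFG.tailMass P j t)
      fun k hk => hR.tailMass_nonneg hM_nonneg (Finset.mem_Icc.1 hk).2 ht
    rw [hfix t ht, InventoryMFG.one_add_phi (by positivity)]
  refine ⟨_, _, hR.isSolution hK hM_sum hphi hle, fun t ht =>
    ⟨fun k hk => hR.tailMass_nonneg hM_nonneg hk ht, ?_, fun k hk1 _ => ⟨?_, ?_⟩⟩⟩
  · rw [InventoryMFG.sum_tailMass, hR.tail.top, sub_zero]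
  · have := hle k hk1 t ht
    have := hphi t ht
    unfold InventoryMFG.rate
    linarith
  · have h1 := (InventoryMFG.bdiff_value_mem_Icc hr hR.value (fun t => (hb _).2) k ht).1
    have h2 := hphi t ht
    have h3 : 0 ≤ b t := le_trans (by positivity) (hb t).1
    unfold InventoryMFG.price
    linarith
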